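/- There is a function $K'(l,n)$ with $K'(l,n)=O(n^3l^2)$ (that is, $K'(l,n)\le C\,n^3l^2$ with an absolute constant $C$) such that the following holds for all integers $n\ge 3$ and $l\ge 1$. Let $B$ (blue points) and $R$ (red points) be disjoint finite sets of points in the plane such that no three points of $B\cup R$ are collinear. Suppose that the convex hull $\mathrm{Conv}(B)$ has exactly $n$ vertices, that $|R|=l$, and that $k\ge K'(l,n)$ points of $B$ lie in the interior of $\mathrm{Conv}(B)$. Then there is a simple (closed, non-self-intersecting) polygon with at most $2n$ vertices, all of them points of $B$ and among them all $n$ vertices of $\mathrm{Conv}(B)$, such that every point of $R$ lies in the exterior of the polygon. -/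

import Mathlib

/-- The Euclidean plane. -/
abbrev Plane : Type := EuclideanSpace ℝ (Fin 2)

/-- A set of points in the plane is in general position if no three distinct points of it
are collinear. -/
def InGeneralPosition (S : Set Plane) : Prop :=
  ∀ a ∈ S, ∀ b ∈ S, ∀ c ∈ S, a ≠ b → a ≠ c → b ≠ c → ¬ Collinear ℝ {a, b, c}

/-- The vertices (0-dimensional faces) of the convex hull of a set of points. -/
def hullVertices (S : Set Plane) : Set Plane :=
  (convexHull ℝ S).extremePoints ℝ

/-- The points of a set that lie in the interior of its convex hull. -/
def innerPoints (S : Set Plane) : Set Plane :=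
  S ∩ interior (convexHull ℝ S)

namespace Polygon

/-- A polygon (a closed polygonal line) is simple if it has at least three vertices, its vertices
are pairwise distinct, and any two distinct sides meet at most in a common endpoint
(the sides are the segments from `poly i` to `poly (finRotate m i)`, the cyclic successor). -/
def IsSimple {m : ℕ} (poly : Polygon Plane m) : Prop :=
  3 ≤ m ∧ Function.Injective poly.vertices ∧
    ∀ i j : Fin m, i ≠ j →
      poly.edgeSet ℝ i ∩ poly.edgeSet ℝ j ⊆
        ({poly i, poly (finRotate m i)} : Set Plane) ∩ {poly j, poly (finRotate m j)}

/-- The exterior of a polygon: the points off its boundary whose connected component in the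
complement of the boundary is unbounded. -/
def exterior {m : ℕ} (poly : Polygon Plane m) : Set Plane :=
  {x | x ∉ poly.boundary ℝ ∧
    ¬ Bornology.IsBounded (connectedComponentIn (poly.boundary ℝ)ᶜ x)}

/-- A polygon excludes a set of points if all of them lie in its exterior. -/
def Excludes {m : ℕ} (poly : Polygon Plane m) (V : Set Plane) : Prop :=
  V ⊆ poly.exterior

end Polygon

/-! Join each hull vertex `v i` to each red point by a line. These `n * l` lines have at most `2 *
(n * l) ^ 2` cells, so among `2 * n ^ 3 * l ^ 2` inner points some `n` share a cell
(`exists_same_signPattern`); call them `Q`. A red point `r` has `Q` strictly on one side of the line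
`v i r`, hence lies outside every `conv ({v i} ∪ Q)`. The union of these hulls is star-shaped about
any point of `Q`, so red points are exterior to every polygon drawn inside it
(`Polygon.mem_exterior_of_starConvex`).

It remains to draw a simple polygon alternating between hull vertices and `Q`. Assign the points of
`Q` to the hull sides so that the product of their distances to the sides is minimal. For two sides
with height functions `d i`, `d j`, the exchange inequality then gives a line `d i = t * d j`
separating the two triangles (`eq_of_mem_segments_of_mul_le`), so their edges can meet only at hull
vertices. -/

/-- Twice the signed area of the triangle `a b c`. -/
def orient (a b c : Plane) : ℝ :=
  (b 0 - a 0) * (c 1 - a 1) - (b 1 - a 1) * (c 0 - a 0)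

theorem orient_self_left (a b : Plane) : orient a b a = 0 := by
  simp [orient]

theorem orient_self_right (a b : Plane) : orient a b b = 0 := by
  simp only [orient]; ring

theorem orient_combo (a b x y : Plane) {s t : ℝ} (h : s + t = 1) :
    orient a b (s • x + t • y) = s * orient a b x + t * orient a b y := by
  obtain rfl : s = 1 - t := by linarith
  simp only [orient, PiLp.add_apply, PiLp.smul_apply, smul_eq_mul]
  ring

theorem orient_rotate (a b c : Plane) : orient b c a = orient a b c := by
  simp only [orient]; ring

theorem orient_swap (a b c : Plane) : orient a c b = -orient a b c := by
  simp only [orient]; ring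

/-- The zero set of a nonconstant affine function on the plane is a line. -/
theorem collinear_of_affine_eq_zero {α β γ : ℝ} (h : α ≠ 0 ∨ β ≠ 0) {p q r : Plane}
    (hp : α * p 0 + β * p 1 + γ = 0) (hq : α * q 0 + β * q 1 + γ = 0)
    (hr : α * r 0 + β * r 1 + γ = 0) : Collinear ℝ {p, q, r} := by
  rw [collinear_iff_of_mem (p₀ := p) (by simp)]
  have hN : 0 < α ^ 2 + β ^ 2 := by rcases h with h | h <;> positivity
  refine ⟨!₂[-β, α], ?_⟩
  have key : ∀ x : Plane, α * x 0 + β * x 1 + γ = 0 →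
      ∃ t : ℝ, x = t • (!₂[-β, α] : Plane) +ᵥ p := by
    intro x hx
    refine ⟨(α * (x 1 - p 1) - β * (x 0 - p 0)) / (α ^ 2 + β ^ 2), ?_⟩
    have h0 : α * (x 0 - p 0) + β * (x 1 - p 1) = 0 := by linarith
    ext i
    fin_cases i
    · simp
      field_simp
      linear_combination α * h0
    · simp
      field_simp
      linear_combination β * h0
  intro x hx
  rcases hx with rfl | rfl | rfl
  exacts [key _ hp, key _ hq, key _ hr]

theorem collinear_of_orient_eq_zero {a b c : Plane} (h : orient a b c = 0) :
    Collinear ℝ {a, b, c} := by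
  by_cases hab : a = b
  · subst hab
    simpa using collinear_pair ℝ a c
  refine collinear_of_affine_eq_zero (α := -(b 1 - a 1)) (β := b 0 - a 0)
    (γ := (b 1 - a 1) * a 0 - (b 0 - a 0) * a 1) ?_ (by ring)
    (by ring) (by rw [← h]; simp only [orient]; ring)
  by_contra! hne
  apply hab
  ext i
  fin_cases i
  · simpa using (sub_eq_zero.1 hne.2).symm
  · simpa using (sub_eq_zero.1 (neg_eq_zero.1 hne.1)).symm

theorem InGeneralPosition.orient_ne_zero {S : Set Plane} (hS : InGeneralPosition S) {a b c : Plane}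
    (ha : a ∈ S) (hb : b ∈ S) (hc : c ∈ S) (hab : a ≠ b) (hac : a ≠ c) (hbc : b ≠ c) :
    orient a b c ≠ 0 :=
  fun h => hS a ha b hb c hc hab hac hbc (collinear_of_orient_eq_zero h)

/-! ### Counting the cells of a line arrangement -/

open Classical in
/-- The indices of the functions `g i` that are positive at `x`. -/
noncomputable def signPattern {ι : Type*} [Fintype ι] (g : ι → Plane → ℝ) (x : Plane) : Finset ι :=
  {i | 0 < g i x}

theorem mem_signPattern {ι : Type*} [Fintype ι] {g : ι → Plane → ℝ} {x : Plane} {i : ι} :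
    i ∈ signPattern g x ↔ 0 < g i x := by
  simp [signPattern]

-- Sauer–Shelah bound with VC dimension at most 2: three affine functions have linearly dependent
-- gradients, so a nontrivial combination of them is constant. Shattering would make that constant
-- both positive and negative.
open Classical in
theorem card_signPattern_le {ι : Type*} [Fintype ι] {g : ι → Plane → ℝ} (α β γ : ι → ℝ)
    (hg : ∀ i x, g i x = α i * x 0 + β i * x 1 + γ i)
    (X : Finset Plane) (hX : ∀ i, ∀ x ∈ X, g i x ≠ 0) :
    (X.image (signPattern g)).card ≤ ∑ k ∈ Finset.Iic 2, (Fintype.card ι).choose k := by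
  refine (Finset.card_le_card_shatterer _).trans (Finset.card_shatterer_le_sum_vcDim.trans ?_)
  refine Finset.sum_le_sum_of_subset (Finset.Iic_subset_Iic.2 ?_)
  refine Finset.sup_le fun s hs => ?_
  rw [Finset.mem_shatterer] at hs
  by_contra! hcard
  have hdep : ¬ LinearIndependent ℝ (fun i : s => (![α i, β i] : Fin 2 → ℝ)) := by
    intro hli
    have := hli.fintype_card_le_finrank
    simp at this
    omega
  obtain ⟨w, hw, i₀, hi₀⟩ := Fintype.not_linearIndependent_iff.1 hdep
  have hα : ∑ i, w i * α i = 0 := by simpa using congrFun hw 0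
  have hβ : ∑ i, w i * β i = 0 := by simpa using congrFun hw 1
  have hconst : ∀ x : Plane, ∑ i : s, w i * g i x = ∑ i : s, w i * γ i := by
    intro x
    have : ∀ i : s, w i * g i x = (w i * α i) * x 0 + (w i * β i) * x 1 + w i * γ i := by
      intro i; rw [hg]; ring
    simp only [this, Finset.sum_add_distrib, ← Finset.sum_mul, hα, hβ]
    ring
  -- Shattering yields a point where the `g i` have the signs of the `u i`, so that no term is
  -- negative.
  have key : ∀ u : s → ℝ, (∃ i, u i ≠ 0) → ∃ x ∈ X, 0 < ∑ i : s, u i * g i x := by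
    rintro u ⟨j, hj⟩
    obtain ⟨t, ht, hst⟩ := hs (t := s.filter fun i => ∃ h : i ∈ s, 0 < u ⟨i, h⟩)
      (Finset.filter_subset _ _)
    obtain ⟨x, hx, rfl⟩ := Finset.mem_image.1 ht
    have hsign : ∀ i : s, 0 < g i x ↔ 0 < u i := by
      intro i
      have := congrArg (fun z => (i : ι) ∈ z) hst
      simpa [mem_signPattern] using this
    refine ⟨x, hx, Finset.sum_pos' (fun i _ => ?_) ⟨j, Finset.mem_univ _, ?_⟩⟩
    · rcases le_or_gt (u i) 0 with h | h
      · exact mul_nonneg_of_nonpos_of_nonpos h (not_lt.1 fun h' => h.not_gt ((hsign i).1 h'))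
      · exact (mul_pos h ((hsign i).2 h)).le
    · rcases hj.lt_or_gt with h | h
      · have h1 : g j x ≤ 0 := not_lt.1 fun h' => h.le.not_gt ((hsign j).1 h')
        exact mul_pos_of_neg_of_neg h (lt_of_le_of_ne h1 (hX _ _ hx))
      · exact mul_pos h ((hsign j).2 h)
  obtain ⟨x, -, hx⟩ := key w ⟨i₀, hi₀⟩
  obtain ⟨y, -, hy⟩ := key (fun i => -w i) ⟨i₀, neg_ne_zero.2 hi₀⟩
  simp only [neg_mul, Finset.sum_neg_distrib, hconst] at hx hy
  linarith

theorem sum_choose_two_le {m : ℕ} (hm : 1 ≤ m) :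
    ∑ k ∈ Finset.Iic 2, m.choose k ≤ 2 * m ^ 2 := by
  have : Finset.Iic 2 = Finset.range 3 := rfl
  rw [this, Finset.sum_range_succ, Finset.sum_range_succ, Finset.sum_range_one]
  have h2 : m.choose 2 * 2 ≤ m * m := by
    rw [Nat.choose_two_right]
    exact (Nat.div_mul_le_self _ _).trans (Nat.mul_le_mul_left _ (Nat.sub_le _ _))
  simp only [Nat.choose_zero_right, Nat.choose_one_right]
  nlinarith

/-- Among sufficiently many points off `m` lines, `n` of them lie in a common cell. -/
theorem exists_same_signPattern {ι : Type*} [Fintype ι] [Nonempty ι] {g : ι → Plane → ℝ}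
    (α β γ : ι → ℝ) (hg : ∀ i x, g i x = α i * x 0 + β i * x 1 + γ i)
    (X : Finset Plane) (hX : ∀ i, ∀ x ∈ X, g i x ≠ 0) (n : ℕ) (hn : 1 ≤ n)
    (hcard : 2 * Fintype.card ι ^ 2 * n ≤ X.card) :
    ∃ q : Fin n → Plane, Function.Injective q ∧ (∀ a, q a ∈ X) ∧
      ∀ i, (∀ a, 0 < g i (q a)) ∨ (∀ a, g i (q a) < 0) := by
  classical
  have hι : 1 ≤ Fintype.card ι := Fintype.card_pos
  have hne : X.Nonempty := by
    rw [← Finset.card_pos]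
    exact lt_of_lt_of_le (by positivity) hcard
  obtain ⟨y, -, hy⟩ := Finset.exists_le_card_fiber_of_mul_le_card_of_maps_to (n := n)
    (s := X) (t := X.image (signPattern g)) (f := signPattern g)
    (fun a ha => Finset.mem_image_of_mem _ ha) (hne.image _)
    (le_trans (Nat.mul_le_mul_right _ ((card_signPattern_le α β γ hg X hX).trans
      (sum_choose_two_le hι))) hcard)
  obtain ⟨Y, hY, hYn⟩ := Finset.exists_subset_card_eq hy
  let e := Y.equivFinOfCardEq hYn
  have hmem : ∀ a, (e.symm a : Plane) ∈ X ∧ signPattern g (e.symm a) = y := fun a =>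
    Finset.mem_filter.1 (hY (e.symm a).2)
  refine ⟨fun a => e.symm a, fun a b h => e.symm.injective (Subtype.ext h),
    fun a => (hmem a).1, fun i => ?_⟩
  by_cases hi : i ∈ y
  · exact Or.inl fun a => mem_signPattern.1 ((hmem a).2 ▸ hi)
  · refine Or.inr fun a => lt_of_le_of_ne (not_lt.1 fun h => hi ?_) (hX _ _ (hmem a).1)
    exact (hmem a).2 ▸ mem_signPattern.2 h

/-! ### Points outside a star-shaped region -/

theorem convex_insert_orient_pos (v r : Plane) :
    Convex ℝ (insert v {x | 0 < orient v r x}) := by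
  intro x hx y hy s t hs ht hst
  rcases hs.eq_or_lt with rfl | hs
  · obtain rfl : t = 1 := by linarith
    simpa using hy
  rcases ht.eq_or_lt with rfl | ht
  · obtain rfl : s = 1 := by linarith
    simpa using hx
  have hv := orient_self_left v r
  simp only [Set.mem_insert_iff, Set.mem_ofPred_eq] at hx hy ⊢
  rcases hx with rfl | hx <;> rcases hy with rfl | hy
  · left; rw [← add_smul, hst, one_smul]
  · right; rw [orient_combo _ _ _ _ hst, hv]; nlinarith
  · right; rw [orient_combo _ _ _ _ hst, hv]; nlinarith
  · right; rw [orient_combo _ _ _ _ hst]; positivity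

theorem convex_insert_orient_neg (v r : Plane) :
    Convex ℝ (insert v {x | orient v r x < 0}) := by
  intro x hx y hy s t hs ht hst
  rcases hs.eq_or_lt with rfl | hs
  · obtain rfl : t = 1 := by linarith
    simpa using hy
  rcases ht.eq_or_lt with rfl | ht
  · obtain rfl : s = 1 := by linarith
    simpa using hx
  have hv := orient_self_left v r
  simp only [Set.mem_insert_iff, Set.mem_ofPred_eq] at hx hy ⊢
  rcases hx with rfl | hx <;> rcases hy with rfl | hy
  · left; rw [← add_smul, hst, one_smul]
  · right; rw [orient_combo _ _ _ _ hst, hv]; nlinarith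
  · right; rw [orient_combo _ _ _ _ hst, hv]; nlinarith
  · right; rw [orient_combo _ _ _ _ hst]; nlinarith

/-- An open half-plane bounded by the line `v r`, with the single boundary point `v` added, is
convex and misses `r`. -/
theorem notMem_convexHull_insert {v r : Plane} (hvr : r ≠ v) {Q : Set Plane}
    (h : (∀ x ∈ Q, 0 < orient v r x) ∨ (∀ x ∈ Q, orient v r x < 0)) :
    r ∉ convexHull ℝ (insert v Q) := by
  intro hr
  have h0 := orient_self_right v r
  rcases h with h | h
  · have := convexHull_min (Set.insert_subset_insert h) (convex_insert_orient_pos v r) hr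
    exact this.elim hvr fun (h : 0 < _) => h.ne' h0
  · have := convexHull_min (Set.insert_subset_insert h) (convex_insert_orient_neg v r) hr
    exact this.elim hvr fun (h : _ < 0) => h.ne h0

/-- The ray from `x` pointing away from `c` avoids `U`, because `x` lies between `c` and each of its
points; it is an unbounded connected set off the boundary. -/
theorem Polygon.mem_exterior_of_starConvex {m : ℕ} {P : Polygon Plane m} {U : Set Plane}
    {c x : Plane} (hU : StarConvex ℝ c U) (hc : c ∈ U) (hP : P.boundary ℝ ⊆ U) (hx : x ∉ U) :
    x ∈ P.exterior := by
  refine ⟨fun h => hx (hP h), fun hb => ?_⟩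
  have hxc : 0 < ‖x - c‖ := by
    rw [norm_pos_iff, sub_ne_zero]
    rintro rfl
    exact hx hc
  let ray : ℝ → Plane := fun s => x + s • (x - c)
  have hpre : IsPreconnected (ray '' Set.Ici 0) :=
    isPreconnected_Ici.image _ (by fun_prop)
  have hsub : ray '' Set.Ici 0 ⊆ (P.boundary ℝ)ᶜ := by
    rintro _ ⟨s, hs, rfl⟩ hmem
    rw [Set.mem_Ici] at hs
    have hs' : 0 < 1 + s := by linarith
    apply hx
    have := hU (hP hmem) (a := s / (1 + s)) (b := 1 / (1 + s)) (by positivity) (by positivity)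
      (by field_simp; ring)
    convert this using 1
    ext i
    simp [ray]
    field_simp
    ring
  have hray := hb.subset (hpre.subset_connectedComponentIn ⟨0, by simp, by simp [ray]⟩ hsub)
  obtain ⟨M, hM⟩ := hray.exists_norm_le
  have hM0 : 0 ≤ M := (norm_nonneg _).trans (hM _ ⟨0, by simp, rfl⟩)
  have h1 := hM _ ⟨(M + ‖x‖ + 1) / ‖x - c‖, by simp; positivity, rfl⟩
  have h2 : ‖((M + ‖x‖ + 1) / ‖x - c‖) • (x - c)‖ = M + ‖x‖ + 1 := by
    rw [norm_smul, Real.norm_of_nonneg (by positivity)]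
    field_simp
  have h3 := norm_sub_le (ray ((M + ‖x‖ + 1) / ‖x - c‖)) x
  simp only [ray, add_sub_cancel_left, h2] at h3 h1
  linarith

/-! ### Cyclic enumeration of points in convex position -/

/-- Each pair of points with distinct second coordinates excludes only one value of `ε`. -/
theorem exists_injOn_shear (V : Finset Plane) :
    ∃ ε : ℝ, Set.InjOn (fun x : Plane => x 0 + ε * x 1) V := by
  classical
  obtain ⟨ε, hε⟩ := Infinite.exists_notMem_finset
    ((V ×ˢ V).image fun p => -(p.1 0 - p.2 0) / (p.1 1 - p.2 1))
  refine ⟨ε, fun x hx y hy hxy => ?_⟩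
  simp only at hxy
  by_cases h1 : x 1 = y 1
  · ext i
    fin_cases i
    · simp only [h1, add_left_inj] at hxy
      exact hxy
    · exact h1
  · refine absurd (Finset.mem_image.2 ⟨(x, y), Finset.mk_mem_product hx hy, ?_⟩) hε
    have : x 1 - y 1 ≠ 0 := sub_ne_zero.2 h1
    field_simp
    linarith

/-- The barycentric coordinates of `p` are ratios of signed areas. -/
theorem mem_convexHull_of_orient {a b c p : Plane} (h : 0 < orient a b c)
    (h1 : 0 ≤ orient a b p) (h2 : 0 ≤ orient b c p) (h3 : 0 ≤ orient c a p) :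
    p ∈ convexHull ℝ {a, b, c} := by
  have hne := h.ne'
  have hp : p = (orient b c p / orient a b c) • a + (orient c a p / orient a b c) • b
      + (orient a b p / orient a b c) • c := by
    ext i
    fin_cases i <;> simp <;> field_simp <;> simp only [orient] <;> ring
  have hsum : orient b c p / orient a b c + orient c a p / orient a b c
      + orient a b p / orient a b c = 1 := by
    field_simp
    simp only [orient]
    ring
  rw [hp]
  have hc := convex_convexHull ℝ ({a, b, c} : Set Plane)
  have key := hc.sum_mem (t := Finset.univ)
    (w := ![orient b c p / orient a b c, orient c a p / orient a b c,
      orient a b p / orient a b c]) (z := ![a, b, c])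
    (by intro i _; fin_cases i <;> simp <;> positivity)
    (by simpa [Fin.sum_univ_three] using hsum)
    (by intro i _; apply subset_convexHull; fin_cases i <;> simp)
  simpa [Fin.sum_univ_three] using key

-- Sort the points by angle around an extreme one, `o`. If a triple avoiding `o` turned the wrong
-- way, its middle point would lie in the triangle formed by `o` and the other two.
open Classical in
theorem exists_orient_pos_enumeration {n : ℕ} (V : Finset Plane) (hn : V.card = n)
    (hne : V.Nonempty) (hV : InGeneralPosition (V : Set Plane))
    (hconv : ∀ x ∈ V, x ∉ convexHull ℝ ((V : Set Plane) \ {x})) :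
    ∃ v : Fin n → Plane, Function.Injective v ∧ Set.range v = V ∧
      ∀ i j k, i < j → j < k → 0 < orient (v i) (v j) (v k) := by
  obtain ⟨ε, hε⟩ := exists_injOn_shear V
  obtain ⟨o, ho, hmin⟩ := V.exists_min_image (fun x : Plane => x 0 + ε * x 1) hne
  have hpos : ∀ x ∈ V, x ≠ o → 0 < (x 0 + ε * x 1) - (o 0 + ε * o 1) := by
    intro x hx hxo
    exact sub_pos.2 (lt_of_le_of_ne (hmin x hx) fun h => hxo (hε hx ho h.symm))
  -- A shear preserves areas, and the sheared abscissa is least at `o`, so the order of slopes is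
  -- the angular order.
  let slope : Plane → ℝ := fun x => (x 1 - o 1) / ((x 0 + ε * x 1) - (o 0 + ε * o 1))
  have horient : ∀ x ∈ V, ∀ y ∈ V, x ≠ o → y ≠ o →
      orient o x y = ((x 0 + ε * x 1) - (o 0 + ε * o 1)) * ((y 0 + ε * y 1) - (o 0 + ε * o 1))
        * (slope y - slope x) := by
    intro x hx y hy hxo hyo
    have h1 := (hpos x hx hxo).ne'
    have h2 := (hpos y hy hyo).ne'
    have sx : slope x * ((x 0 + ε * x 1) - (o 0 + ε * o 1)) = x 1 - o 1 := div_mul_cancel₀ _ h1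
    have sy : slope y * ((y 0 + ε * y 1) - (o 0 + ε * o 1)) = y 1 - o 1 := div_mul_cancel₀ _ h2
    simp only [orient]
    linear_combination ((y 0 + ε * y 1) - (o 0 + ε * o 1)) * sx
      - ((x 0 + ε * x 1) - (o 0 + ε * o 1)) * sy
  have hlt : ∀ x ∈ V, ∀ y ∈ V, x ≠ o → y ≠ o → slope x < slope y → 0 < orient o x y := by
    intro x hx y hy hxo hyo h
    rw [horient x hx y hy hxo hyo]
    exact mul_pos (mul_pos (hpos x hx hxo) (hpos y hy hyo)) (sub_pos.2 h)
  -- The value `⊥` puts `o` first.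
  let key : Plane → WithBot ℝ := fun x => if x = o then ⊥ else (slope x : WithBot ℝ)
  have hkey : Set.InjOn key V := by
    intro x hx y hy hxy
    by_cases hxo : x = o <;> by_cases hyo : y = o
    · rw [hxo, hyo]
    · simp [key, hxo, hyo] at hxy
    · simp [key, hxo, hyo] at hxy
    · simp only [key, hxo, hyo, if_false, WithBot.coe_inj] at hxy
      by_contra hne
      refine hV.orient_ne_zero ho hx hy (Ne.symm hxo) (Ne.symm hyo) hne ?_
      rw [horient x hx y hy hxo hyo, hxy, sub_self, mul_zero]
  let e := (V.equivFinOfCardEq hn).symm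
  let f : Fin n → WithBot ℝ := fun i => key (e i)
  have hf : Function.Injective f := fun i j h =>
    e.injective (Subtype.ext (hkey (e i).2 (e j).2 h))
  let v : Fin n → Plane := fun i => e (Tuple.sort f i)
  have hvV : ∀ i, v i ∈ V := fun i => (e _).2
  have hvinj : Function.Injective v := fun i j h =>
    (Tuple.sort f).injective (e.injective (Subtype.ext h))
  have hmono : StrictMono fun i => key (v i) :=
    (Tuple.monotone_sort f).strictMono_of_injective (hf.comp (Tuple.sort f).injective)
  have hnot : ∀ i j, i < j → v j ≠ o := by
    intro i j hij h
    have := hmono hij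
    simp [key, h] at this
  have hslope : ∀ i j, i < j → v i ≠ o → 0 < orient o (v i) (v j) := by
    intro i j hij hi
    have hj := hnot i j hij
    have := hmono hij
    simp only [key, hi, hj, if_false, WithBot.coe_lt_coe] at this
    exact hlt _ (hvV i) _ (hvV j) hi hj this
  refine ⟨v, hvinj, ?_, fun i j k hij hjk => ?_⟩
  · ext x
    constructor
    · rintro ⟨i, rfl⟩
      exact hvV i
    · intro hx
      exact ⟨(Tuple.sort f).symm (e.symm ⟨x, hx⟩), by simp [v]⟩
  · have hj := hnot i j hij
    by_cases hi : v i = o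
    · rw [hi]
      exact hslope j k hjk hj
    · by_contra! hle
      apply hconv (v j) (hvV j)
      refine convexHull_mono ?_ (mem_convexHull_of_orient (a := o) (b := v i) (c := v k)
        (hslope i k (hij.trans hjk) hi) (hslope i j hij hi).le ?_ ?_)
      · rintro x (rfl | rfl | rfl)
        · exact ⟨ho, fun h => hj h.symm⟩
        · exact ⟨hvV i, fun h => hij.ne (hvinj h)⟩
        · exact ⟨hvV k, fun h => hjk.ne (hvinj h.symm)⟩
      · rw [orient_swap]
        linarith
      · have := hslope j k hjk hj
        simp only [orient] at this ⊢
        linarith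

theorem finRotate_val {n : ℕ} (i : Fin n) :
    (finRotate n i : ℕ) = if (i : ℕ) + 1 = n then 0 else (i : ℕ) + 1 := by
  obtain ⟨m, rfl⟩ : ∃ m, n = m + 1 := ⟨n - 1, by have := i.2; omega⟩
  rw [coe_finRotate]
  simp [Fin.ext_iff]

theorem orient_finRotate_pos {n : ℕ} {v : Fin n → Plane}
    (h : ∀ i j k, i < j → j < k → 0 < orient (v i) (v j) (v k)) (i j : Fin n)
    (hi : j ≠ i) (hi' : j ≠ finRotate n i) : 0 < orient (v i) (v (finRotate n i)) (v j) := by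
  have hval := finRotate_val i
  rw [Ne, Fin.ext_iff] at hi hi'
  have h1 := i.2
  have h2 := j.2
  split_ifs at hval with hlast
  · rw [← orient_rotate]
    exact h _ _ _ (by rw [Fin.lt_def]; omega) (by rw [Fin.lt_def]; omega)
  · rcases lt_or_gt_of_ne hi with hlt | hlt
    · rw [orient_rotate]
      exact h _ _ _ (by rw [Fin.lt_def]; omega) (by rw [Fin.lt_def]; omega)
    · exact h _ _ _ (by rw [Fin.lt_def]; omega) (by rw [Fin.lt_def]; omega)

/-! ### Assigning an inner point to every side -/

/-- Take `σ` minimizing the product of all `d i (σ i)`, compare it with its composition with a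
transposition, and cancel the common positive factors. -/
theorem exists_perm_mul_le {n : ℕ} (d : Fin n → Fin n → ℝ) (hd : ∀ i a, 0 < d i a) :
    ∃ σ : Equiv.Perm (Fin n), ∀ i j, i ≠ j →
      d i (σ i) * d j (σ j) ≤ d i (σ j) * d j (σ i) := by
  obtain ⟨σ, -, hσ⟩ := Finset.exists_min_image Finset.univ
    (fun σ : Equiv.Perm (Fin n) => ∏ i, d i (σ i)) Finset.univ_nonempty
  refine ⟨σ, fun i j hij => ?_⟩
  have h := hσ ((Equiv.swap i j).trans σ) (Finset.mem_univ _)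
  have hj : j ∈ Finset.univ.erase i := Finset.mem_erase.2 ⟨hij.symm, Finset.mem_univ _⟩
  have hrest : ∏ k ∈ (Finset.univ.erase i).erase j, d k (((Equiv.swap i j).trans σ) k)
      = ∏ k ∈ (Finset.univ.erase i).erase j, d k (σ k) := by
    refine Finset.prod_congr rfl fun k hk => ?_
    simp only [Finset.mem_erase] at hk
    rw [Equiv.trans_apply, Equiv.swap_apply_of_ne_of_ne hk.2.1 hk.1]
  rw [← Finset.mul_prod_erase _ _ (Finset.mem_univ i), ← Finset.mul_prod_erase _ _ hj,
    ← Finset.mul_prod_erase Finset.univ _ (Finset.mem_univ i), ← Finset.mul_prod_erase _ _ hj,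
    hrest, ← mul_assoc, ← mul_assoc] at h
  have hprod : 0 < ∏ k ∈ (Finset.univ.erase i).erase j, d k (σ k) :=
    Finset.prod_pos fun k _ => hd _ _
  simpa using le_of_mul_le_mul_right h hprod

/-- Two segments on opposite sides of a line, the second endpoints off that line. -/
theorem eq_of_mem_segments_of_separated {f : Plane → ℝ}
    (hf : ∀ x y s t, s + t = 1 → f (s • x + t • y) = s * f x + t * f y)
    {a b c e x : Plane} (ha : f a ≤ 0) (hb : f b < 0) (hc : 0 ≤ f c) (he : 0 < f e)
    (h1 : x ∈ segment ℝ a b) (h2 : x ∈ segment ℝ c e) : x = a ∧ x = c := by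
  obtain ⟨s, t, hs, ht, hst, rfl⟩ := h1
  obtain ⟨s', t', hs', ht', hst', hx⟩ := h2
  have e1 := hf a b s t hst
  have e2 := hf c e s' t' hst'
  rw [hx, e1] at e2
  have n1 : s * f a ≤ 0 := mul_nonpos_of_nonneg_of_nonpos hs ha
  have n2 : t * f b ≤ 0 := mul_nonpos_of_nonneg_of_nonpos ht hb.le
  have n3 : 0 ≤ s' * f c := mul_nonneg hs' hc
  have n4 : 0 ≤ t' * f e := mul_nonneg ht' he.le
  have t0 : t = 0 := by
    by_contra hne
    have := mul_neg_of_pos_of_neg (lt_of_le_of_ne ht (Ne.symm hne)) hb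
    linarith
  have t0' : t' = 0 := by
    by_contra hne
    have := mul_pos (lt_of_le_of_ne ht' (Ne.symm hne)) he
    linarith
  subst t0 t0'
  obtain rfl : s = 1 := by linarith
  obtain rfl : s' = 1 := by linarith
  refine ⟨by simp, ?_⟩
  rw [← hx]
  simp

/-- Points assigned to the sides of a convex polygon so that no exchange of two of them decreases
the product of the heights span noncrossing triangles with these sides. -/
theorem eq_of_mem_segments_of_mul_le {n : ℕ} (hn : 3 ≤ n) {v q : Fin n → Plane}
    (hpos : ∀ i j, j ≠ i → j ≠ finRotate n i → 0 < orient (v i) (v (finRotate n i)) (v j))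
    (hqpos : ∀ i a, 0 < orient (v i) (v (finRotate n i)) (q a))
    (hq : Function.Injective q)
    (hcol : ∀ i a b, a ≠ b → ¬ Collinear ℝ {v i, q a, q b})
    {i j : Fin n} (hij : i ≠ j)
    (hle : orient (v i) (v (finRotate n i)) (q i) * orient (v j) (v (finRotate n j)) (q j) ≤
      orient (v i) (v (finRotate n i)) (q j) * orient (v j) (v (finRotate n j)) (q i))
    {a b : Fin n} (ha : a = i ∨ a = finRotate n i) (hb : b = j ∨ b = finRotate n j) {x : Plane}
    (h1 : x ∈ segment ℝ (v a) (q i)) (h2 : x ∈ segment ℝ (v b) (q j)) :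
    x = v a ∧ x = v b := by
  set d : Fin n → Plane → ℝ := fun i x => orient (v i) (v (finRotate n i)) x with hd
  have hd0 : ∀ i a, a = i ∨ a = finRotate n i → d i (v a) = 0 := by
    rintro i a (rfl | rfl)
    exacts [orient_self_left _ _, orient_self_right _ _]
  have hdnn : ∀ i a, 0 ≤ d i (v a) := by
    intro i a
    by_cases h : a = i ∨ a = finRotate n i
    · exact (hd0 i a h).ge
    · push Not at h
      exact (hpos i a h.1 h.2).le
  change d i (q i) * d j (q j) ≤ d i (q j) * d j (q i) at hle
  have haff : ∀ t : ℝ, ∀ x y s s', s + s' = 1 → (d i (s • x + s' • y) - t * d j (s • x + s' • y))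
      = s * (d i x - t * d j x) + s' * (d i y - t * d j y) := by
    intro t x y s s' h
    simp only [hd, orient_combo _ _ _ _ h]
    ring
  have pi : 0 < d j (q i) := hqpos j i
  have pj : 0 < d j (q j) := hqpos j j
  rcases hle.lt_or_eq with hlt | heq
  -- For `t` strictly between the two ratios, `d i - t * d j` is negative at `q i`, positive at `q
  -- j`, and weakly of the same respective signs at the ends of sides `i` and `j`.
  · have hr : d i (q i) / d j (q i) < d i (q j) / d j (q j) := by
      rw [div_lt_div_iff₀ pi pj]
      linarith
    obtain ⟨t, ht1, ht2⟩ := exists_between hr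
    rw [div_lt_iff₀ pi] at ht1
    rw [lt_div_iff₀ pj] at ht2
    have ht0 : 0 < t := by
      have := hqpos i i
      change 0 < d i (q i) at this
      by_contra! h
      nlinarith
    refine eq_of_mem_segments_of_separated (f := fun x => d i x - t * d j x) (haff t)
      ?_ ?_ ?_ ?_ h1 h2
    · rw [hd0 i a ha]
      have := mul_nonneg ht0.le (hdnn j a)
      linarith
    · linarith
    · rw [hd0 j b hb]
      have := hdnn i b
      linarith
    · linarith
  -- With equality, the line `d i = t * d j` passes through `q i` and `q j`. A common end of the two
  -- sides would be a third point on it, against general position; without one, the side ends are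
  -- strictly separated, and an intersection would force `q i = q j`.
  · exfalso
    set t := d i (q i) / d j (q i) with ht
    have ht0 : 0 < t := div_pos (hqpos i i) pi
    have ti : d i (q i) - t * d j (q i) = 0 := by
      rw [ht]; field_simp; ring
    have tj : d i (q j) - t * d j (q j) = 0 := by
      rw [ht]; field_simp; linarith
    have hshared : ∀ c, (c = i ∨ c = finRotate n i) → (c = j ∨ c = finRotate n j) → False := by
      intro c hci hcj
      have hc : d i (v c) - t * d j (v c) = 0 := by
        rw [hd0 i c hci, hd0 j c hcj]; ring
      -- The zero set is a genuine line: the function is nonzero at an end of side `i` that is not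
      -- an end of side `j`, which exists since `n ≥ 3`.
      obtain ⟨k, hk⟩ : ∃ k, d i (v k) - t * d j (v k) ≠ 0 := by
        obtain ⟨k, hki, hkj, hkj'⟩ :
            ∃ k, (k = i ∨ k = finRotate n i) ∧ k ≠ j ∧ k ≠ finRotate n j := by
          by_cases h : i = finRotate n j
          · refine ⟨finRotate n i, Or.inr rfl, fun h' => ?_, fun h' => ?_⟩
            · have e1 := finRotate_val i
              have e2 := finRotate_val j
              rw [h'] at e1
              rw [← h] at e2
              have := i.2
              have := j.2
              split_ifs at e1 e2 <;> omega
            · exact hij ((finRotate n).injective h')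
          · exact ⟨i, Or.inl rfl, hij, h⟩
        refine ⟨k, ?_⟩
        rw [hd0 i k hki]
        have := mul_pos ht0 (hpos j k hkj hkj')
        change 0 < t * d j (v k) at this
        linarith
      refine hcol c i j hij ?_
      have hform : ∀ p : Plane, d i p - t * d j p =
          (-((v (finRotate n i)) 1 - v i 1) + t * ((v (finRotate n j)) 1 - v j 1)) * p 0 +
          (((v (finRotate n i)) 0 - v i 0) - t * ((v (finRotate n j)) 0 - v j 0)) * p 1 +
          (((v (finRotate n i)) 1 - v i 1) * v i 0 - ((v (finRotate n i)) 0 - v i 0) * v i 1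
          - t * (((v (finRotate n j)) 1 - v j 1) * v j 0
            - ((v (finRotate n j)) 0 - v j 0) * v j 1)) := by
        intro p
        simp only [hd, orient]
        ring
      rw [hform] at hc ti tj hk
      refine collinear_of_affine_eq_zero ?_ hc ti tj
      by_contra! h0
      rw [h0.1, h0.2] at hk hc
      apply hk
      linarith
    have sa : d i (v a) - t * d j (v a) < 0 := by
      have : 0 < d j (v a) := hpos j a (fun h => hshared a ha (Or.inl h))
        (fun h => hshared a ha (Or.inr h))
      rw [hd0 i a ha]
      have := mul_pos ht0 this
      linarith
    have sb : 0 < d i (v b) - t * d j (v b) := by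
      have : 0 < d i (v b) := hpos i b (fun h => hshared b (Or.inl h) hb)
        (fun h => hshared b (Or.inr h) hb)
      rw [hd0 j b hb]
      linarith
    rw [segment_symm] at h1 h2
    have := eq_of_mem_segments_of_separated (f := fun x => d i x - t * d j x) (haff t)
      ti.le sa tj.ge sb h1 h2
    exact hij (hq (this.1.symm.trans this.2))

/-! ### The alternating polygon -/

/-- The closed polygonal line `v 0, q 0, v 1, q 1, …`. -/
def alternatingPolygon {n : ℕ} (v q : Fin n → Plane) : Polygon Plane (2 * n) :=
  ⟨fun j => if (j : ℕ) % 2 = 0 then v ⟨j / 2, by have := j.2; omega⟩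
    else q ⟨j / 2, by have := j.2; omega⟩⟩

section alternatingPolygon

variable {n : ℕ} (v q : Fin n → Plane)

theorem alternatingPolygon_even (i : Fin n) :
    alternatingPolygon v q ⟨2 * i, by omega⟩ = v i := by
  simp [alternatingPolygon]

theorem alternatingPolygon_odd (i : Fin n) :
    alternatingPolygon v q ⟨2 * i + 1, by omega⟩ = q i := by
  have h1 : (2 * (i : ℕ) + 1) % 2 = 1 := by omega
  have h2 : (2 * (i : ℕ) + 1) / 2 = i := by omega
  simp [alternatingPolygon, h1, h2]

theorem finRotate_even (i : Fin n) :
    finRotate (2 * n) ⟨2 * i, by omega⟩ = ⟨2 * i + 1, by omega⟩ := by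
  rw [Fin.ext_iff, finRotate_val]
  simp
  omega

theorem finRotate_odd (i : Fin n) :
    finRotate (2 * n) ⟨2 * i + 1, by omega⟩ = ⟨2 * (finRotate n i : Fin n), by omega⟩ := by
  rw [Fin.ext_iff, finRotate_val]
  simp only [finRotate_val i]
  split_ifs <;> omega

theorem exists_eq_even_or_odd (j : Fin (2 * n)) :
    ∃ i : Fin n, j = ⟨2 * i, by omega⟩ ∨ j = ⟨2 * i + 1, by omega⟩ := by
  have := j.2
  refine ⟨⟨j / 2, by omega⟩, ?_⟩
  simp only [Fin.ext_iff]
  omega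

theorem edgeSet_alternatingPolygon_even (i : Fin n) :
    (alternatingPolygon v q).edgeSet ℝ ⟨2 * i, by omega⟩ = segment ℝ (v i) (q i) := by
  rw [Polygon.edgeSet, finRotate_even, alternatingPolygon_even, alternatingPolygon_odd,
    affineSegment_eq_segment]

theorem edgeSet_alternatingPolygon_odd (i : Fin n) :
    (alternatingPolygon v q).edgeSet ℝ ⟨2 * i + 1, by omega⟩ =
      segment ℝ (v (finRotate n i)) (q i) := by
  rw [Polygon.edgeSet, finRotate_odd, alternatingPolygon_even, alternatingPolygon_odd,
    affineSegment_eq_segment, segment_symm]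

theorem range_alternatingPolygon :
    Set.range (alternatingPolygon v q).vertices = Set.range v ∪ Set.range q := by
  ext x
  constructor
  · rintro ⟨j, rfl⟩
    obtain ⟨i, rfl | rfl⟩ := exists_eq_even_or_odd j
    · exact Or.inl ⟨i, (alternatingPolygon_even v q i).symm⟩
    · exact Or.inr ⟨i, (alternatingPolygon_odd v q i).symm⟩
  · rintro (⟨i, rfl⟩ | ⟨i, rfl⟩)
    · exact ⟨_, alternatingPolygon_even v q i⟩
    · exact ⟨_, alternatingPolygon_odd v q i⟩

theorem boundary_alternatingPolygon_subset {U : Set Plane}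
    (hU : ∀ i j, segment ℝ (v i) (q j) ⊆ U) : (alternatingPolygon v q).boundary ℝ ⊆ U := by
  refine Set.iUnion_subset fun j => ?_
  obtain ⟨i, rfl | rfl⟩ := exists_eq_even_or_odd j
  · rw [edgeSet_alternatingPolygon_even]
    exact hU _ _
  · rw [edgeSet_alternatingPolygon_odd]
    exact hU _ _

variable {v q}

theorem isSimple_alternatingPolygon (hn : 3 ≤ n) (hv : Function.Injective v)
    (hq : Function.Injective q) (hvq : ∀ i j, v i ≠ q j)
    (hqpos : ∀ i, orient (v i) (v (finRotate n i)) (q i) ≠ 0)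
    (hcross : ∀ i j, i ≠ j → ∀ a b, (a = i ∨ a = finRotate n i) → (b = j ∨ b = finRotate n j) →
      ∀ x ∈ segment ℝ (v a) (q i), x ∈ segment ℝ (v b) (q j) → x = v a ∧ x = v b) :
    (alternatingPolygon v q).IsSimple := by
  -- The height over side `i` fixes the weight of `q i`, so a common point has the same weights on
  -- both edges; as the base ends differ, their weight is zero.
  have hsame : ∀ i, ∀ x ∈ segment ℝ (v i) (q i),
      x ∈ segment ℝ (v (finRotate n i)) (q i) → x = q i := by
    rintro i x ⟨s, t, hs, ht, hst, rfl⟩ ⟨s', t', hs', ht', hst', hx⟩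
    have h := congrArg (orient (v i) (v (finRotate n i))) hx
    rw [orient_combo _ _ _ _ hst, orient_combo _ _ _ _ hst', orient_self_left,
      orient_self_right, mul_zero, mul_zero, zero_add, zero_add] at h
    obtain rfl := mul_right_cancel₀ (hqpos i) h
    obtain rfl : s' = s := by linarith
    have hne : v (finRotate n i) ≠ v i := by
      intro h
      have h1 := finRotate_val i
      rw [hv h] at h1
      split_ifs at h1 <;> omega
    rw [add_left_inj] at hx
    have hs0 : s' = 0 := by
      by_contra h0
      exact hne (smul_right_injective _ h0 hx)
    subst hs0
    obtain rfl : t' = 1 := by linarith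
    simp
  refine ⟨by omega, fun j j' h => ?_, fun j j' hjj' => ?_⟩
  · obtain ⟨i, rfl | rfl⟩ := exists_eq_even_or_odd j <;>
    obtain ⟨i', rfl | rfl⟩ := exists_eq_even_or_odd j' <;>
    simp only [alternatingPolygon_even, alternatingPolygon_odd] at h
    · rw [hv h]
    · exact absurd h (hvq _ _)
    · exact absurd h.symm (hvq _ _)
    · rw [hq h]
  · rintro x ⟨hx, hx'⟩
    obtain ⟨i, rfl | rfl⟩ := exists_eq_even_or_odd j <;>
    obtain ⟨i', rfl | rfl⟩ := exists_eq_even_or_odd j' <;>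
    simp only [edgeSet_alternatingPolygon_even, edgeSet_alternatingPolygon_odd] at hx hx' <;>
    simp only [finRotate_even, finRotate_odd, alternatingPolygon_even, alternatingPolygon_odd]
    · have hii : i ≠ i' := by rintro rfl; exact hjj' rfl
      obtain ⟨h1, h2⟩ := hcross i i' hii i i' (by simp) (by simp) x hx hx'
      exact ⟨Or.inl h1, Or.inl h2⟩
    · by_cases hii : i = i'
      · subst hii
        simp [hsame i x hx hx']
      obtain ⟨h1, h2⟩ := hcross i i' hii i _ (by simp) (Or.inr rfl) x hx hx'
      exact ⟨Or.inl h1, Or.inr h2⟩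
    · by_cases hii : i = i'
      · subst hii
        simp [hsame i x hx' hx]
      obtain ⟨h1, h2⟩ := hcross i i' hii _ i' (Or.inr rfl) (by simp) x hx hx'
      exact ⟨Or.inr h1, Or.inl h2⟩
    · have hii : i ≠ i' := by rintro rfl; exact hjj' rfl
      obtain ⟨h1, h2⟩ := hcross i i' hii _ _ (Or.inr rfl) (Or.inr rfl) x hx hx'
      exact ⟨Or.inr h1, Or.inr h2⟩

end alternatingPolygon

/-! ### Hull vertices and inner points -/

theorem hullVertices_subset (B : Set Plane) : hullVertices B ⊆ B :=
  extremePoints_convexHull_subset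

/-- Krein–Milman; the closure is superfluous because the vertices are finite in number. -/
theorem convexHull_hullVertices (B : Finset Plane) :
    convexHull ℝ (hullVertices (B : Set Plane)) = convexHull ℝ (B : Set Plane) := by
  have hfin : (hullVertices (B : Set Plane)).Finite :=
    B.finite_toSet.subset (hullVertices_subset _)
  rw [← closure_convexHull_extremePoints (B.finite_toSet.isCompact_convexHull ℝ)
    (convex_convexHull ℝ _)]
  exact (hfin.isClosed_convexHull ℝ).closure_eq.symm

theorem notMem_convexHull_hullVertices_diff {B : Set Plane} {x : Plane}
    (hx : x ∈ hullVertices B) : x ∉ convexHull ℝ (hullVertices B \ {x}) := by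
  have h := ((convex_convexHull ℝ B).mem_extremePoints_iff_mem_sdiff_convexHull_sdiff).1 hx
  refine fun h' => h.2 (convexHull_mono ?_ h')
  exact Set.sdiff_subset_sdiff_left extremePoints_subset

theorem notMem_hullVertices_of_mem_innerPoints {B : Set Plane} {x : Plane}
    (hx : x ∈ innerPoints B) : x ∉ hullVertices B :=
  fun h => Set.disjoint_left.1 (disjoint_interior_extremePoints _) hx.2 h

theorem convex_orient_nonneg (a b : Plane) : Convex ℝ {x | 0 ≤ orient a b x} := by
  intro x hx y hy s t hs ht hst
  change 0 ≤ orient a b _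
  rw [orient_combo _ _ _ _ hst]
  exact add_nonneg (mul_nonneg hs hx) (mul_nonneg ht hy)

/-! ### The main theorem -/

theorem theorem2 :
    ∃ (K' : ℕ → ℕ → ℕ) (C : ℕ),
      (∀ l n : ℕ, K' l n ≤ C * (n ^ 3 * l ^ 2)) ∧
      ∀ (l n k : ℕ) (B R : Finset Plane),
        1 ≤ l → 3 ≤ n →
        Disjoint B R →
        InGeneralPosition ((B : Set Plane) ∪ (R : Set Plane)) →
        (hullVertices (B : Set Plane)).ncard = n →
        (innerPoints (B : Set Plane)).ncard = k →
        R.card = l →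
        K' l n ≤ k →
        ∃ (m : ℕ) (P : Polygon Plane m),
          m ≤ 2 * n ∧
          P.IsSimple ∧
          Set.range P.vertices ⊆ (B : Set Plane) ∧
          hullVertices (B : Set Plane) ⊆ Set.range P.vertices ∧
          P.Excludes (R : Set Plane) := by
  refine ⟨fun l n => 2 * (n ^ 3 * l ^ 2), 2, fun _ _ => le_rfl, ?_⟩
  intro l n k B R hl hn hBR hgen hVn hk hR hK
  have hdisj : ∀ x ∈ B, ∀ y ∈ R, x ≠ y := fun x hx y hy h =>
    Finset.disjoint_left.1 hBR hx (h ▸ hy)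
  have hVfin : (hullVertices (B : Set Plane)).Finite :=
    B.finite_toSet.subset (hullVertices_subset _)
  have hXfin : (innerPoints (B : Set Plane)).Finite :=
    B.finite_toSet.subset Set.inter_subset_left
  have hVcard : hVfin.toFinset.card = n := by
    rw [← Set.ncard_eq_toFinset_card _ hVfin, hVn]
  have hVne : hVfin.toFinset.Nonempty := by
    rw [← Finset.card_pos]
    omega
  obtain ⟨v, hv, hvr, hvo⟩ := exists_orient_pos_enumeration hVfin.toFinset hVcard hVne
    (by
      intro a ha b hb c hc
      rw [hVfin.coe_toFinset] at ha hb hc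
      exact hgen a (Or.inl (hullVertices_subset _ ha)) b (Or.inl (hullVertices_subset _ hb))
        c (Or.inl (hullVertices_subset _ hc)))
    (by
      intro x hx
      rw [hVfin.coe_toFinset]
      exact notMem_convexHull_hullVertices_diff (hVfin.mem_toFinset.1 hx))
  rw [hVfin.coe_toFinset] at hvr
  have hvV : ∀ i, v i ∈ hullVertices (B : Set Plane) := fun i => hvr ▸ Set.mem_range_self i
  have hvB : ∀ i, v i ∈ B := fun i => hullVertices_subset _ (hvV i)
  have hpos := orient_finRotate_pos hvo
  have hrot : ∀ i, v i ≠ v (finRotate n i) := by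
    intro i h
    have h1 := finRotate_val i
    rw [← hv h] at h1
    split_ifs at h1 <;> omega
  have hinner : ∀ x ∈ innerPoints (B : Set Plane), ∀ i, v i ≠ x := by
    rintro x hx i rfl
    exact notMem_hullVertices_of_mem_innerPoints hx (hvV i)
  have hinner_pos : ∀ x ∈ innerPoints (B : Set Plane), ∀ i,
      0 < orient (v i) (v (finRotate n i)) x := by
    intro x hx i
    have hmem : x ∈ convexHull ℝ (hullVertices (B : Set Plane)) := by
      rw [convexHull_hullVertices]
      exact interior_subset hx.2
    have hnn := convexHull_min (fun y hy => ?_)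
      (convex_orient_nonneg (v i) (v (finRotate n i))) hmem
    · exact lt_of_le_of_ne hnn (hgen.orient_ne_zero (Or.inl (hvB _)) (Or.inl (hvB _))
        (Or.inl hx.1) (hrot i) (hinner x hx _) (hinner x hx _)).symm
    · rw [← hvr] at hy
      obtain ⟨j, rfl⟩ := hy
      by_cases h : j = i ∨ j = finRotate n i
      · rcases h with rfl | rfl
        exacts [(orient_self_left _ _).ge, (orient_self_right _ _).ge]
      · push Not at h
        exact (hpos i j h.1 h.2).le
  have : Nonempty (Fin n × R) := by
    obtain ⟨r, hr⟩ : R.Nonempty := by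
      rw [← Finset.card_pos]
      omega
    exact ⟨⟨⟨0, by omega⟩, ⟨r, hr⟩⟩⟩
  -- The cells are those of the `n * l` lines joining hull vertices to red points, whence the bound
  -- `2 * (n * l) ^ 2 * n`.
  obtain ⟨q, hq, hqX, hqsign⟩ := exists_same_signPattern
    (g := fun p : Fin n × R => orient (v p.1) p.2)
    (fun p => -((p.2 : Plane) 1 - v p.1 1)) (fun p => (p.2 : Plane) 0 - v p.1 0)
    (fun p => ((p.2 : Plane) 1 - v p.1 1) * v p.1 0 - ((p.2 : Plane) 0 - v p.1 0) * v p.1 1)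
    (by intro p x; simp only [orient]; ring)
    hXfin.toFinset
    (by
      rintro ⟨i, r⟩ x hx
      rw [Set.Finite.mem_toFinset] at hx
      exact hgen.orient_ne_zero (Or.inl (hvB i)) (Or.inr r.2) (Or.inl hx.1)
        (hdisj _ (hvB i) _ r.2) (hinner x hx i) (hdisj _ hx.1 _ r.2).symm)
    n (by omega)
    (by
      rw [← Set.ncard_eq_toFinset_card _ hXfin, hk, Fintype.card_prod, Fintype.card_fin,
        Fintype.card_coe, hR]
      refine le_trans (le_of_eq ?_) hK
      ring)
  simp only [Set.Finite.mem_toFinset] at hqX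
  obtain ⟨σ, hσ⟩ := exists_perm_mul_le (fun i a => orient (v i) (v (finRotate n i)) (q a))
    (fun i a => hinner_pos _ (hqX a) i)
  have hqB : ∀ a, q a ∈ B := fun a => (hqX a).1
  have hrange : Set.range (q ∘ σ) = Set.range q := by simp
  refine ⟨2 * n, alternatingPolygon v (q ∘ σ), le_rfl, ?_, ?_, ?_, ?_⟩
  · refine isSimple_alternatingPolygon hn hv (hq.comp σ.injective)
      (fun i j => hinner _ (hqX _) i) (fun i => (hinner_pos _ (hqX _) i).ne') ?_
    intro i j hij a b ha hb x h1 h2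
    refine eq_of_mem_segments_of_mul_le hn hpos (fun i a => hinner_pos _ (hqX _) i)
      (hq.comp σ.injective) ?_ hij (hσ i j hij) ha hb h1 h2
    intro i a b hab
    exact hgen _ (Or.inl (hvB i)) _ (Or.inl (hqB _)) _ (Or.inl (hqB _))
      (hinner _ (hqX _) i) (hinner _ (hqX _) i) fun h => hab (σ.injective (hq h))
  · rw [range_alternatingPolygon, hrange]
    rintro x (⟨i, rfl⟩ | ⟨i, rfl⟩)
    exacts [hvB i, hqB i]
  · rw [range_alternatingPolygon, ← hvr]
    exact Set.subset_union_left
  · intro r hr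
    have hmem : ∀ i j, q j ∈ convexHull ℝ (insert (v i) (Set.range q)) := fun i j =>
      subset_convexHull ℝ _ (Or.inr ⟨j, rfl⟩)
    let z : Fin n := ⟨0, by omega⟩
    -- All the convex pieces contain `q z`, so their union is star-shaped about it.
    refine Polygon.mem_exterior_of_starConvex
      (U := ⋃ i, convexHull ℝ (insert (v i) (Set.range q))) (c := q z) ?_ ?_ ?_ ?_
    · exact starConvex_iUnion fun i => (convex_convexHull ℝ _).starConvex (hmem i z)
    · exact Set.mem_iUnion.2 ⟨z, hmem z z⟩
    · refine boundary_alternatingPolygon_subset _ _ fun i j => ?_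
      refine Set.Subset.trans ?_ (Set.subset_iUnion _ i)
      exact (convex_convexHull ℝ _).segment_subset
        (subset_convexHull ℝ _ (Set.mem_insert _ _)) (hmem i _)
    · rw [Set.mem_iUnion]
      rintro ⟨i, hi⟩
      refine notMem_convexHull_insert (hdisj _ (hvB i) _ hr).symm ?_ hi
      simpa only [Set.forall_mem_range] using hqsign (i, ⟨r, hr⟩)
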